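/- Let $0<\lambda<1$. There is a unique entire function $g$ with $g'(z)=-g(\lambda z)$ for all $z\in\mathbb C$ and $g(0)=1$. Put $$A=\frac12-\frac1{\log\lambda}-\frac{\log(-\log\lambda)}{\log\lambda},\qquad B=\frac{\log(-\log\lambda)}{\log\lambda}-1,$$ $$C=\exp\left(-\frac{\log\lambda}8+\log(-\log\lambda)-\frac{(\log(-\log\lambda))^2}{2\log\lambda}-\frac12\log(2\pi)\right),$$ and, for $x\in\mathbb C$, $$H(x)=\sqrt{\frac{2\pi}{-\log\lambda}}\sum_{k\in\mathbb Z}e^{\frac{(2k+1)^2\pi^2}{2\log\lambda}}e^{\pi i(2k+1)x}.$$ This series converges absolutely for every $x\in\mathbb C$, and $H(x+2)=H(x)$. With principal branches of all logarithms and powers, put $$P(z)=Cz^A(\log z)^B\exp\left(-\frac1{2\log\lambda}\left(\log z-\log\log z\right)^2\right),$$ $$Y(z)=\frac1{\log\lambda}\left(\log z-\log\log z\right)-\frac12+\frac{\log(-\log\lambda)}{\log\lambda}.$$ Then, for every $\varepsilon>0$, $$g(z)=P(z)\bigl(H(Y(z))+o(1)\bigr)\qquad\text{as } z\to\infty,\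 |\operatorname{Arg}z|\le\pi-\varepsilon,$$ uniformly in this sector. In particular, for every $\delta>0$, $g(z)\sim P(z)\,H(Y(z))$ (the quotient tends to $1$) as $z\to\infty$ with $|\operatorname{Arg} z|\le\pi-\varepsilon$ and $|H(Y(z))|\ge\delta$. -/

import Mathlib

open Filter Topology Asymptotics

noncomputable section

namespace Pantograph

/-- `g` is an entire solution of `g'(z) = -g(lam z)` with `g(0) = 1`. -/
def IsEntireSolution (lam : ℝ) (g : ℂ → ℂ) : Prop :=
  Differentiable ℂ g ∧ (∀ z : ℂ, deriv g z = -g ((lam : ℂ) * z)) ∧ g 0 = 1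

/-- The exponent of `z`. -/
def expA (lam : ℝ) : ℝ :=
  1 / 2 - 1 / Real.log lam - Real.log (-Real.log lam) / Real.log lam

/-- The exponent of `log z`. -/
def expB (lam : ℝ) : ℝ :=
  Real.log (-Real.log lam) / Real.log lam - 1

/-- The multiplicative constant. -/
def constC (lam : ℝ) : ℝ :=
  Real.exp (-Real.log lam / 8 + Real.log (-Real.log lam)
    - Real.log (-Real.log lam) ^ 2 / (2 * Real.log lam)
    - Real.log (2 * Real.pi) / 2)

/-- The `k`-th term of the Fourier series of the theta-type function. -/
def fourierTerm (lam : ℝ) (x : ℂ) (k : ℤ) : ℂ :=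
  Complex.exp ((2 * (k : ℂ) + 1) ^ 2 * (Real.pi : ℂ) ^ 2 / (2 * (Real.log lam : ℂ)))
    * Complex.exp ((Real.pi : ℂ) * Complex.I * (2 * (k : ℂ) + 1) * x)

/-- The theta-type function `H`, as a function of a complex variable. -/
def thetaH (lam : ℝ) (x : ℂ) : ℂ :=
  (Real.sqrt (2 * Real.pi / (-Real.log lam)) : ℂ) * ∑' k : ℤ, fourierTerm lam x k

/-- The function `C z^A (log z)^B exp(-(log z - log log z)^2 / (2 log lam))`,
with principal branches. -/
def prefactor (lam : ℝ) (z : ℂ) : ℂ :=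
  (constC lam : ℂ) * z ^ (expA lam : ℂ) * Complex.log z ^ (expB lam : ℂ)
    * Complex.exp (-(1 / (2 * (Real.log lam : ℂ)))
        * (Complex.log z - Complex.log (Complex.log z)) ^ 2)

/-- The point at which `H` is evaluated. -/
def phase (lam : ℝ) (z : ℂ) : ℂ :=
  1 / (Real.log lam : ℂ) * (Complex.log z - Complex.log (Complex.log z)) - 1 / 2
    + (Real.log (-Real.log lam) : ℂ) / (Real.log lam : ℂ)

/-- The closed sector `|Arg z| ≤ π - ε`. -/
def sector (ε : ℝ) : Set ℂ := {z | |Complex.arg z| ≤ Real.pi - ε}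

end Pantograph

end

/-! The equation forces `g(z) = ∑ (-1)^n λ^(n choose 2) z^n / n!`. Put `L = -log λ` and `u = log z /
L`, and replace `1/n!` by the Poisson weight `e^{-u} u^n / n!` measured against `(2πu)^{-1/2}`.
Completing the square in `n` turns the `n`-th term into `P(z)` times an alternating Gaussian centred
at `c = u - log u / L + 1/2 = -Y(z)`, times that ratio (`seriesTerm_eq`). As `z → ∞`, `Re u → ∞`
while `|Im u| ≤ π/L`. The Gaussian has fixed width, and `c` is only `O(log |u|)` from `u`, far
inside the Poisson scale `√|u|`; so the ratio tends to 1 where the Gaussian lives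
(`tendsto_poissonRatio`), and elsewhere it grows at most linearly (`norm_poissonRatio_le`).
Dominated convergence leaves the Gaussian sum over `ℤ` (`tendsto_tsum_poissonRatio_sub`), which is
`H(Y(z))` by Poisson summation (`thetaH_eq_tsum_gaussTerm`). -/

namespace Pantograph

/-! ### The entire solution -/

/-- The `n`-th term of the power series of the entire solution. -/
noncomputable def seriesTerm (lam : ℝ) (z : ℂ) (n : ℕ) : ℂ :=
  (-1) ^ n * (lam : ℂ) ^ n.choose 2 * z ^ n / (n.factorial : ℂ)

theorem seriesTerm_zero (lam : ℝ) (z : ℂ) : seriesTerm lam z 0 = 1 := by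
  simp [seriesTerm]

theorem seriesTerm_mul (lam : ℝ) (z : ℂ) (n : ℕ) :
    seriesTerm lam ((lam : ℂ) * z) n
      = (-1) ^ n * (lam : ℂ) ^ (n + 1).choose 2 * z ^ n / (n.factorial : ℂ) := by
  rw [seriesTerm, Nat.choose_succ_succ' n 1, Nat.choose_one_right, mul_pow, pow_add]
  ring

theorem norm_seriesTerm_le {lam : ℝ} (h0 : 0 < lam) (h1 : lam < 1) (z : ℂ) (n : ℕ) :
    ‖seriesTerm lam z n‖ ≤ ‖z‖ ^ n / n.factorial := by
  have h : |lam| ^ n.choose 2 ≤ 1 := pow_le_one₀ (abs_nonneg _) (by rw [abs_of_pos h0]; exact h1.le)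
  simp only [seriesTerm, norm_div, norm_mul, norm_pow, norm_neg, norm_one, one_pow, one_mul,
    Complex.norm_real, Real.norm_eq_abs, Complex.norm_natCast]
  gcongr
  exact mul_le_of_le_one_left (by positivity) h

theorem summable_seriesTerm {lam : ℝ} (h0 : 0 < lam) (h1 : lam < 1) (z : ℂ) :
    Summable (seriesTerm lam z) :=
  .of_norm_bounded (Real.summable_pow_div_factorial ‖z‖) (norm_seriesTerm_le h0 h1 z)

theorem hasDerivAt_seriesTerm_succ (lam : ℝ) (z : ℂ) (n : ℕ) :
    HasDerivAt (fun w => seriesTerm lam w (n + 1)) (-seriesTerm lam ((lam : ℂ) * z) n) z := by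
  have h := (((hasDerivAt_pow (n + 1) z).const_mul
    ((-1) ^ (n + 1) * (lam : ℂ) ^ (n + 1).choose 2)).div_const ((n + 1).factorial : ℂ))
  refine h.congr_deriv ?_
  rw [seriesTerm_mul, Nat.factorial_succ]
  have : (n.factorial : ℂ) ≠ 0 := by exact_mod_cast n.factorial_ne_zero
  have : (n : ℂ) + 1 ≠ 0 := by exact_mod_cast n.succ_ne_zero
  push_cast
  field_simp
  ring

theorem hasDerivAt_tsum_seriesTerm {lam : ℝ} (h0 : 0 < lam) (h1 : lam < 1) (z : ℂ) :
    HasDerivAt (fun w => ∑' n, seriesTerm lam w n)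
      (-∑' n, seriesTerm lam ((lam : ℂ) * z) n) z := by
  have key : HasDerivAt (fun w => ∑' n, seriesTerm lam w (n + 1))
      (∑' n, -seriesTerm lam ((lam : ℂ) * z) n) z := by
    refine hasDerivAt_tsum_of_isPreconnected (t := Metric.ball 0 (‖z‖ + 1)) (y₀ := z)
      (Real.summable_pow_div_factorial (‖z‖ + 1)) Metric.isOpen_ball
      (convex_ball _ _).isPreconnected (fun n w _ => hasDerivAt_seriesTerm_succ lam w n) ?_
      (by simp) ((summable_nat_add_iff 1).2 (summable_seriesTerm h0 h1 z)) (by simp)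
    intro n w hw
    rw [norm_neg]
    refine (norm_seriesTerm_le h0 h1 _ n).trans ?_
    have hw' : ‖w‖ < ‖z‖ + 1 := by simpa using hw
    rw [norm_mul, Complex.norm_real, Real.norm_eq_abs, abs_of_pos h0]
    have : lam * ‖w‖ ≤ ‖z‖ + 1 := (mul_le_of_le_one_left (norm_nonneg _) h1.le).trans hw'.le
    gcongr
  rw [tsum_neg] at key
  refine (key.const_add 1).congr_of_eventuallyEq (.of_forall fun w => ?_)
  simp only
  rw [(summable_seriesTerm h0 h1 w).tsum_eq_zero_add, seriesTerm_zero]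

theorem isEntireSolution_tsum {lam : ℝ} (h0 : 0 < lam) (h1 : lam < 1) :
    IsEntireSolution lam (fun z => ∑' n, seriesTerm lam z n) := by
  refine ⟨fun z => (hasDerivAt_tsum_seriesTerm h0 h1 z).differentiableAt,
    fun z => (hasDerivAt_tsum_seriesTerm h0 h1 z).deriv, ?_⟩
  change ∑' n, seriesTerm lam 0 n = 1
  rw [tsum_eq_single 0, seriesTerm_zero]
  intro n hn
  simp [seriesTerm, hn]

/-- At `0` this determines every Taylor coefficient, hence uniqueness. -/
theorem IsEntireSolution.iteratedDeriv_eq {lam : ℝ} {g : ℂ → ℂ} (hg : IsEntireSolution lam g)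
    (n : ℕ) : iteratedDeriv n g
      = fun z => (-1) ^ n * (lam : ℂ) ^ n.choose 2 * g ((lam : ℂ) ^ n * z) := by
  induction n with
  | zero => simp
  | succ n ih =>
    rw [iteratedDeriv_succ, ih]
    ext z
    have h : HasDerivAt g (-g ((lam : ℂ) * ((lam : ℂ) ^ n * z))) ((lam : ℂ) ^ n * z) := by
      rw [← hg.2.1]; exact (hg.1 _).hasDerivAt
    have h2 := (h.comp z ((hasDerivAt_id z).const_mul ((lam : ℂ) ^ n))).const_mul
      ((-1) ^ n * (lam : ℂ) ^ n.choose 2)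
    refine h2.deriv.trans ?_
    rw [Nat.choose_succ_succ' n 1, Nat.choose_one_right, pow_add, pow_succ (-1 : ℂ),
      pow_succ (lam : ℂ), mul_comm ((lam : ℂ) ^ n) (lam : ℂ), mul_assoc (lam : ℂ)]
    ring

theorem IsEntireSolution.eq_tsum {lam : ℝ} {g : ℂ → ℂ} (hg : IsEntireSolution lam g) (z : ℂ) :
    g z = ∑' n, seriesTerm lam z n := by
  rw [← Complex.taylorSeries_eq_of_entire' 0 z hg.1]
  refine tsum_congr fun n => ?_
  rw [hg.iteratedDeriv_eq]
  simp only [mul_zero, hg.2.2, seriesTerm, sub_zero]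
  ring

/-! ### Poisson summation for the theta-type function -/

/-- The `n`-th term of the alternating Gaussian series. -/
noncomputable def gaussTerm (L : ℝ) (x : ℂ) (n : ℤ) : ℂ :=
  (-1) ^ n * Complex.exp (-(L : ℂ) / 2 * (n + x) ^ 2)

theorem neg_one_zpow_eq_exp (n : ℤ) :
    (-1 : ℂ) ^ n = Complex.exp (-(Real.pi * Complex.I * n)) := by
  have : (-1 : ℂ) = Complex.exp (-(Real.pi * Complex.I)) := by
    rw [Complex.exp_neg, Complex.exp_pi_mul_I]; norm_num
  rw [this, ← Complex.exp_int_mul]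
  ring_nf

theorem gaussTerm_eq_jacobi (L : ℝ) (x : ℂ) (n : ℤ) :
    gaussTerm L x n = Complex.exp (-(L : ℂ) / 2 * x ^ 2)
      * jacobiTheta₂_term n (-1 / 2 - L * x / (2 * Real.pi * Complex.I))
        (Complex.I * L / (2 * Real.pi)) := by
  have hpi : (Real.pi : ℂ) ≠ 0 := by exact_mod_cast Real.pi_ne_zero
  rw [gaussTerm, neg_one_zpow_eq_exp, jacobiTheta₂_term, ← Complex.exp_add, ← Complex.exp_add]
  congr 1
  field_simp
  ring_nf
  simp only [Complex.I_sq]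
  ring

theorem fourierTerm_eq_jacobi {lam : ℝ} (h0 : 0 < lam) (h1 : lam < 1) (x : ℂ) (n : ℤ) :
    fourierTerm lam x n
      = Complex.exp ((Real.pi : ℂ) ^ 2 / (2 * (Real.log lam : ℂ)) + Real.pi * Complex.I * x)
      * jacobiTheta₂_term n (-(Complex.I * Real.pi / Real.log lam) + x)
        (-(2 * Real.pi * Complex.I / Real.log lam)) := by
  have hL : (Real.log lam : ℂ) ≠ 0 := by exact_mod_cast (Real.log_neg h0 h1).ne
  rw [fourierTerm, jacobiTheta₂_term, ← Complex.exp_add, ← Complex.exp_add]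
  congr 1
  field_simp
  ring_nf
  simp only [Complex.I_sq]
  ring

theorem summable_gaussTerm {L : ℝ} (hL : 0 < L) (x : ℂ) : Summable (gaussTerm L x) := by
  have hpi := Real.pi_pos
  simp_rw [funext (gaussTerm_eq_jacobi L x)]
  refine ((summable_jacobiTheta₂_term_iff _ _).2 ?_).mul_left _
  have : Complex.I * L / (2 * Real.pi) = ((L / (2 * Real.pi) : ℝ) : ℂ) * Complex.I := by
    push_cast; ring
  rw [this, Complex.im_ofReal_mul, Complex.I_im]
  positivity

theorem summable_fourierTerm {lam : ℝ} (h0 : 0 < lam) (h1 : lam < 1) (x : ℂ) :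
    Summable (fourierTerm lam x) := by
  have hL : 0 < -Real.log lam := neg_pos.2 (Real.log_neg h0 h1)
  have hpi := Real.pi_pos
  simp_rw [funext (fourierTerm_eq_jacobi h0 h1 x)]
  refine ((summable_jacobiTheta₂_term_iff _ _).2 ?_).mul_left _
  have : -(2 * Real.pi * Complex.I / Real.log lam)
      = ((2 * Real.pi / (-Real.log lam) : ℝ) : ℂ) * Complex.I := by
    push_cast; ring
  rw [this, Complex.im_ofReal_mul, Complex.I_im]
  positivity

/-- Poisson summation in the form of the functional equation of `jacobiTheta₂` under `τ ↦ -1/τ`,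
with `τ = iL/(2π)`. The sign `(-1)^n` is a shift of the first argument by `-1/2`, which becomes the
odd frequencies `2k+1`. -/
theorem thetaH_eq_tsum_gaussTerm {lam : ℝ} (h0 : 0 < lam) (h1 : lam < 1) (x : ℂ) :
    thetaH lam x = ∑' n : ℤ, gaussTerm (-Real.log lam) x n := by
  obtain ⟨L, hLdef⟩ : ∃ L, L = -Real.log lam := ⟨_, rfl⟩
  have hL : 0 < L := hLdef ▸ neg_pos.2 (Real.log_neg h0 h1)
  have hlog : Real.log lam = -L := by rw [hLdef, neg_neg]
  have hpi : (Real.pi : ℂ) ≠ 0 := by exact_mod_cast Real.pi_ne_zero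
  have hLc : (L : ℂ) ≠ 0 := by exact_mod_cast hL.ne'
  rw [thetaH]
  simp_rw [funext (fourierTerm_eq_jacobi h0 h1 x), hlog, neg_neg, funext (gaussTerm_eq_jacobi L x),
    tsum_mul_left]
  rw [← jacobiTheta₂, ← jacobiTheta₂, jacobiTheta₂_functional_equation (-1 / 2 - _)]
  have e1 : (-1 / 2 - L * x / (2 * Real.pi * Complex.I)) / (Complex.I * L / (2 * Real.pi))
      = -(Complex.I * Real.pi / ((-L : ℝ) : ℂ)) + x := by
    push_cast
    field_simp
    ring_nf
    simp only [Complex.I_sq, Complex.I_pow_three]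
    ring
  have e2 : -1 / (Complex.I * L / (2 * Real.pi))
      = -(2 * Real.pi * Complex.I / ((-L : ℝ) : ℂ)) := by
    push_cast
    field_simp
    simp [Complex.I_sq]
  have e3 : 1 / (-Complex.I * (Complex.I * L / (2 * Real.pi))) ^ (1 / 2 : ℂ)
      = (Real.sqrt (2 * Real.pi / L) : ℂ) := by
    have : -Complex.I * (Complex.I * L / (2 * Real.pi)) = ((L / (2 * Real.pi) : ℝ) : ℂ) := by
      push_cast
      rw [mul_div_assoc, ← mul_assoc, neg_mul, Complex.I_mul_I]; ring
    rw [this, Real.sqrt_eq_rpow, ← inv_div (L : ℝ), Real.inv_rpow (by positivity),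
      Complex.ofReal_inv, Complex.ofReal_cpow (by positivity)]
    simp
  rw [e1, e2, e3]
  have e4 : Complex.exp (-(L : ℂ) / 2 * x ^ 2) * Complex.exp (-(Real.pi : ℂ) * Complex.I
        * (-1 / 2 - L * x / (2 * Real.pi * Complex.I)) ^ 2 / (Complex.I * L / (2 * Real.pi)))
      = Complex.exp ((Real.pi : ℂ) ^ 2 / (2 * ((-L : ℝ) : ℂ)) + Real.pi * Complex.I * x) := by
    rw [← Complex.exp_add]
    congr 1
    push_cast
    field_simp
    ring_nf
    simp only [Complex.I_sq, Complex.I_pow_three]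
    ring
  rw [← e4]
  ring

theorem thetaH_periodic (lam : ℝ) : Function.Periodic (thetaH lam) 2 := by
  intro x
  rw [thetaH, thetaH]
  congr 1
  refine tsum_congr fun k => ?_
  rw [fourierTerm, fourierTerm]
  congr 1
  rw [Complex.exp_eq_exp_iff_exists_int]
  exact ⟨2 * k + 1, by push_cast; ring⟩

/-! ### Poisson weights with complex mean -/

/-- The Poisson weight `e^{-u} u^n / n!` divided by its Gaussian size `(2πu)^{-1/2}`. -/
noncomputable def poissonRatio (u : ℂ) (n : ℕ) : ℂ :=
  (Real.sqrt (2 * Real.pi) : ℂ) * Complex.exp (Complex.log u / 2) * Complex.exp (-u) * u ^ n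
    / (n.factorial : ℂ)

theorem norm_exp_log_div_two {u : ℂ} (hu : u ≠ 0) :
    ‖Complex.exp (Complex.log u / 2)‖ = Real.sqrt ‖u‖ := by
  have h : 0 < ‖u‖ := norm_pos_iff.2 hu
  rw [Complex.norm_exp, Real.sqrt_eq_rpow, Real.rpow_def_of_pos h]
  congr 1
  have : Complex.log u / 2 = ((1 / 2 : ℝ) : ℂ) * Complex.log u := by push_cast; ring
  rw [this, Complex.re_ofReal_mul, Complex.log_re]
  ring

theorem sqrt_mul_poisson_zero_le {a : ℝ} (ha : 0 < a) :
    Real.sqrt (2 * Real.pi) * Real.sqrt a * Real.exp (-a) ≤ 3 := by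
  have h1 : Real.sqrt (2 * Real.pi) ≤ 3 := by
    rw [Real.sqrt_le_left (by norm_num)]
    linarith [Real.pi_lt_four]
  have h2 : Real.sqrt a * Real.exp (-a) ≤ 1 := by
    rw [Real.exp_neg, ← div_eq_mul_inv, div_le_one (Real.exp_pos _)]
    refine le_trans ?_ (Real.add_one_le_exp a)
    rw [Real.sqrt_le_left (by positivity)]
    nlinarith
  calc _ = Real.sqrt (2 * Real.pi) * (Real.sqrt a * Real.exp (-a)) := mul_assoc _ _ _
    _ ≤ 3 * 1 := by gcongr
    _ = 3 := by norm_num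

/-- Stirling's lower bound for `n!` combined with `x ≤ e^{x-1}` at `x = a/n`. -/
theorem sqrt_mul_poisson_le {a : ℝ} (ha : 0 < a) {n : ℕ} (hn : n ≠ 0) :
    Real.sqrt (2 * Real.pi) * Real.sqrt a * Real.exp (-a) * a ^ n / n.factorial
      ≤ Real.sqrt (a / n) := by
  have hn' : (0 : ℝ) < n := by exact_mod_cast Nat.pos_of_ne_zero hn
  have hst := Stirling.le_factorial_stirling n
  have hpos : 0 < Real.sqrt (2 * Real.pi * n) * (n / Real.exp 1) ^ n := by
    have := Real.pi_pos
    positivity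
  refine (div_le_div_of_nonneg_left (by positivity) hpos hst).trans ?_
  rw [div_le_iff₀ hpos, Real.sqrt_mul (by positivity) (n : ℝ), Real.sqrt_div ha.le]
  have key : Real.exp (-a) * a ^ n ≤ (n / Real.exp 1) ^ n := by
    have h1 : a / n ≤ Real.exp (a / n - 1) := by linarith [Real.add_one_le_exp (a / n - 1)]
    have h2 : (a / n) ^ n ≤ Real.exp (a - n) := by
      calc (a / n) ^ n ≤ Real.exp (a / n - 1) ^ n := by gcongr
        _ = Real.exp (a - n) := by
          rw [← Real.exp_nat_mul]; congr 1; field_simp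
    rw [div_pow, div_le_iff₀ (by positivity), Real.exp_sub] at h2
    rw [div_pow, ← Real.exp_nat_mul, mul_one, Real.exp_neg]
    rw [div_mul_eq_mul_div, le_div_iff₀ (Real.exp_pos _)] at h2
    rw [le_div_iff₀ (Real.exp_pos _), mul_assoc, inv_mul_le_iff₀ (Real.exp_pos _)]
    exact h2
  have hs : Real.sqrt n ≠ 0 := by positivity
  calc _ = Real.sqrt (2 * Real.pi) * Real.sqrt a * (Real.exp (-a) * a ^ n) := by ring
    _ ≤ Real.sqrt (2 * Real.pi) * Real.sqrt a * (n / Real.exp 1) ^ n := by gcongr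
    _ = _ := by field_simp

/-- Since `‖u‖ ≤ Re u + M`, passing to the real mean `‖u‖` costs a factor `e^M`. Linear growth in
the distance from `ρ` is crude, but harmless against a Gaussian. -/
theorem norm_poissonRatio_le {u : ℂ} (hu : 0 < u.re) {M ρ : ℝ} (hM : |u.im| ≤ M)
    (hρ : ‖u‖ ≤ 2 * ρ) (n : ℕ) :
    ‖poissonRatio u n‖ ≤ 3 * Real.exp M * (1 + |n - ρ|) := by
  have hu0 : u ≠ 0 := fun h => by simp [h] at hu
  have ha : 0 < ‖u‖ := norm_pos_iff.2 hu0
  have hexp : Real.exp (-u.re) ≤ Real.exp M * Real.exp (-‖u‖) := by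
    rw [← Real.exp_add]
    have := Complex.norm_le_abs_re_add_abs_im u
    rw [abs_of_pos hu] at this
    exact Real.exp_le_exp.2 (by linarith)
  have h1 : ‖poissonRatio u n‖ ≤ Real.exp M *
      (Real.sqrt (2 * Real.pi) * Real.sqrt ‖u‖ * Real.exp (-‖u‖) * ‖u‖ ^ n / n.factorial) := by
    rw [poissonRatio, norm_div, norm_mul, norm_mul, norm_mul, norm_exp_log_div_two hu0,
      Complex.norm_real, Real.norm_of_nonneg (Real.sqrt_nonneg _), norm_pow, Complex.norm_natCast,
      Complex.norm_exp, Complex.neg_re]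
    calc _ ≤ Real.sqrt (2 * Real.pi) * Real.sqrt ‖u‖ * (Real.exp M * Real.exp (-‖u‖)) * ‖u‖ ^ n
          / n.factorial := by gcongr
      _ = _ := by ring
  have h2 : Real.sqrt (2 * Real.pi) * Real.sqrt ‖u‖ * Real.exp (-‖u‖) * ‖u‖ ^ n / n.factorial
      ≤ 3 * (1 + |n - ρ|) := by
    have habs := abs_nonneg ((n : ℝ) - ρ)
    rcases eq_or_ne n 0 with rfl | hn
    · have := sqrt_mul_poisson_zero_le ha
      simp only [pow_zero, Nat.factorial_zero, Nat.cast_one, mul_one, div_one]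
      linarith
    · refine (sqrt_mul_poisson_le ha hn).trans ?_
      have hn' : (1 : ℝ) ≤ n := by exact_mod_cast Nat.one_le_iff_ne_zero.2 hn
      -- For `n ≥ 1`, `ρ ≤ n + |n - ρ| ≤ n (1 + |n - ρ|)`.
      have h3 : ‖u‖ / n ≤ 2 * (1 + |n - ρ|) := by
        rw [div_le_iff₀ (by linarith)]
        have := neg_abs_le ((n : ℝ) - ρ)
        nlinarith
      rw [Real.sqrt_le_left (by positivity)]
      nlinarith
  calc _ ≤ _ := h1
    _ ≤ Real.exp M * (3 * (1 + |n - ρ|)) := by gcongr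
    _ = _ := by ring

/-- Exact form of the Poisson weight relative to Stirling's approximation. -/
theorem poissonRatio_eq {u : ℂ} {n : ℕ} (hn : n ≠ 0) (hu : u ≠ 0) :
    poissonRatio u n
      = ((Real.sqrt (2 * n * Real.pi) * (n / Real.exp 1) ^ n / n.factorial : ℝ) : ℂ)
        * Complex.exp (Complex.log (u / n) / 2)
        * Complex.exp (n * (Complex.log (1 + (u - n) / n) - (u - n) / n)) := by
  have hn' : (0 : ℝ) < n := by exact_mod_cast Nat.pos_of_ne_zero hn
  have hnc : (n : ℂ) ≠ 0 := by exact_mod_cast hn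
  have e0 : 1 + (u - n) / n = u / n := by field_simp; ring
  have hun : u / n ≠ 0 := div_ne_zero hu hnc
  have e1 : Complex.log u = Real.log n + Complex.log (u / n) := by
    rw [← Complex.log_ofReal_mul hn' hun]
    congr 1
    push_cast
    field_simp
  have e2 : Complex.exp (n * (Complex.log (1 + (u - n) / n) - (u - n) / n))
      = u ^ n / n ^ n * Complex.exp (n - u) := by
    rw [e0, mul_sub, Complex.exp_sub, Complex.exp_nat_mul, Complex.exp_log hun, div_pow,
      mul_div_cancel₀ _ hnc, div_eq_mul_inv, ← Complex.exp_neg, neg_sub]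
  have e3 : Complex.exp ((Real.log n : ℂ) / 2) = (Real.sqrt n : ℂ) := by
    rw [Real.sqrt_eq_rpow, Real.rpow_def_of_pos hn']
    push_cast
    ring_nf
  have e4 : Real.sqrt (2 * n * Real.pi) = Real.sqrt (2 * Real.pi) * Real.sqrt n := by
    rw [← Real.sqrt_mul (by positivity)]; ring_nf
  have e5 : (Complex.exp 1) ^ n = Complex.exp n := by rw [← Complex.exp_nat_mul, mul_one]
  rw [e2, e4, poissonRatio, e1, add_div, Complex.exp_add, e3]
  push_cast
  rw [div_pow, e5, Complex.exp_sub, Complex.exp_neg]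
  have := Complex.exp_ne_zero (n : ℂ)
  field_simp

/-- With `t = (u - n)/n`, the exponent `n (log(1+t) - t)` is `O(n |t|²) = O(|u - n|²/n)`; the
Stirling quotient and `√(u/n)` tend to 1 separately. -/
theorem tendsto_poissonRatio {α : Type*} {l : Filter α} {u : α → ℂ} {n : α → ℕ}
    (hn : Tendsto n l atTop) (hu : ∀ᶠ a in l, u a ≠ 0)
    (h : Tendsto (fun a => ‖u a - n a‖ ^ 2 / n a) l (𝓝 0)) :
    Tendsto (fun a => poissonRatio (u a) (n a)) l (𝓝 1) := by
  have hnpos : ∀ᶠ a in l, 1 ≤ n a := hn.eventually_ge_atTop 1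
  have ht : Tendsto (fun a => (u a - n a) / n a) l (𝓝 0) := by
    rw [tendsto_zero_iff_norm_tendsto_zero]
    have hs : Tendsto (fun a => Real.sqrt (‖u a - n a‖ ^ 2 / n a)) l (𝓝 0) := by
      have := (Real.continuous_sqrt.tendsto 0).comp h
      rwa [Real.sqrt_zero] at this
    refine squeeze_zero' (.of_forall fun _ => norm_nonneg _) ?_ hs
    filter_upwards [hnpos] with a ha
    have ha' : (1 : ℝ) ≤ n a := by exact_mod_cast ha
    rw [norm_div, Complex.norm_natCast]
    refine Real.le_sqrt_of_sq_le ?_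
    rw [div_pow]
    gcongr
    nlinarith
  have hst : Tendsto (fun a => ((Real.sqrt (2 * n a * Real.pi) * (n a / Real.exp 1) ^ n a
      / (n a).factorial : ℝ) : ℂ)) l (𝓝 1) := by
    have h1 := Stirling.factorial_isEquivalent_stirling.symm
    rw [isEquivalent_iff_tendsto_one (.of_forall fun n => by
      exact_mod_cast n.factorial_ne_zero)] at h1
    have h2 := (Complex.continuous_ofReal.tendsto (1 : ℝ)).comp (h1.comp hn)
    rw [Complex.ofReal_one] at h2
    exact h2
  have hlog : Tendsto (fun a => Complex.exp (Complex.log (u a / n a) / 2)) l (𝓝 1) := by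
    have h1 : Tendsto (fun a => 1 + (u a - n a) / n a) l (𝓝 1) := by
      simpa using tendsto_const_nhds.add ht
    have h2 : ContinuousAt (fun w => Complex.exp (Complex.log w / 2)) 1 := by
      refine Complex.continuous_exp.continuousAt.comp ?_
      exact (continuousAt_clog (by simp)).div_const 2
    have h3 := h2.tendsto.comp h1
    simp only [Complex.log_one, zero_div, Complex.exp_zero] at h3
    refine h3.congr' ?_
    filter_upwards [hnpos] with a ha
    have : (n a : ℂ) ≠ 0 := by exact_mod_cast (Nat.one_le_iff_ne_zero.1 ha)
    simp only [Function.comp]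
    congr 3
    field_simp
    ring
  have hexp : Tendsto (fun a => Complex.exp (n a *
      (Complex.log (1 + (u a - n a) / n a) - (u a - n a) / n a))) l (𝓝 1) := by
    have h0 := Complex.continuous_exp.tendsto 0
    rw [Complex.exp_zero] at h0
    refine h0.comp ?_
    rw [tendsto_zero_iff_norm_tendsto_zero]
    refine squeeze_zero' (.of_forall fun _ => norm_nonneg _) ?_ h
    have hsmall : ∀ᶠ a in l, ‖(u a - n a) / n a‖ < 1 / 2 := by
      have := ht.norm
      rw [norm_zero] at this
      exact this.eventually_lt_const (by norm_num)
    filter_upwards [hnpos, hsmall] with a ha hs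
    have ha' : (1 : ℝ) ≤ n a := by exact_mod_cast ha
    have hb := Complex.norm_log_one_add_sub_self_le (hs.trans (by norm_num))
    have hinv : (1 - ‖(u a - n a) / n a‖)⁻¹ ≤ 2 := by
      rw [inv_le_comm₀ (by linarith) (by norm_num)]
      linarith
    rw [norm_mul, Complex.norm_natCast]
    calc _ ≤ (n a : ℝ) * (‖(u a - n a) / n a‖ ^ 2 * 2 / 2) := by
          refine mul_le_mul_of_nonneg_left (hb.trans ?_) (by positivity)
          gcongr
      _ = ‖u a - n a‖ ^ 2 / n a := by
          rw [norm_div, Complex.norm_natCast]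
          field_simp
  have hall := (hst.mul hlog).mul hexp
  rw [mul_one, mul_one] at hall
  refine hall.congr' ?_
  filter_upwards [hnpos, hu] with a ha hua
  exact (poissonRatio_eq (Nat.one_le_iff_ne_zero.1 ha) hua).symm

/-! ### Comparison of the power series with the Gaussian series -/

theorem norm_gaussTerm (L : ℝ) (x : ℂ) (n : ℤ) :
    ‖gaussTerm L x n‖ = Real.exp (-(L / 2) * ((n + x.re) ^ 2 - x.im ^ 2)) := by
  rw [gaussTerm, norm_mul, norm_zpow, norm_neg, norm_one, one_zpow, one_mul, Complex.norm_exp]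
  congr 1
  have : -(L : ℂ) / 2 = ((-(L / 2) : ℝ) : ℂ) := by push_cast; ring
  rw [this, Complex.re_ofReal_mul]
  congr 1
  simp [pow_two]

/-- The centre of the Gaussian series attached to `u`. -/
noncomputable def centre (L : ℝ) (u : ℂ) : ℂ := u - Complex.log u / L + 1 / 2

theorem centre_re (L : ℝ) (u : ℂ) :
    (centre L u).re = u.re - Real.log ‖u‖ / L + 1 / 2 := by
  simp [centre, Complex.div_ofReal_re, Complex.log_re]

theorem abs_centre_im_le {L : ℝ} (hL : 0 < L) {u : ℂ} {M : ℝ} (hM : |u.im| ≤ M) :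
    |(centre L u).im| ≤ M + Real.pi / L := by
  have h : (centre L u).im = u.im - Complex.arg u / L := by
    simp [centre, Complex.div_ofReal_im, Complex.log_im]
  rw [h]
  refine (abs_sub _ _).trans (add_le_add hM ?_)
  rw [abs_div, abs_of_pos hL]
  gcongr
  exact Complex.abs_arg_le_pi u

/-- The Poisson ratio, extended by zero to negative indices. -/
noncomputable def poissonRatioInt (u : ℂ) (k : ℤ) : ℂ :=
  if 0 ≤ k then poissonRatio u k.toNat else 0

theorem poissonRatioInt_natCast (u : ℂ) (n : ℕ) : poissonRatioInt u n = poissonRatio u n := by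
  simp [poissonRatioInt]

theorem norm_poissonRatioInt_le {u : ℂ} (hu : 0 < u.re) {M ρ : ℝ} (hM : |u.im| ≤ M)
    (hρ : ‖u‖ ≤ 2 * ρ) (k : ℤ) :
    ‖poissonRatioInt u k‖ ≤ 3 * Real.exp M * (1 + |k - ρ|) := by
  rw [poissonRatioInt]
  split_ifs with hk
  · have h := norm_poissonRatio_le hu hM hρ k.toNat
    have : ((k.toNat : ℕ) : ℝ) = (k : ℝ) := by exact_mod_cast Int.toNat_of_nonneg hk
    rwa [this] at h
  · rw [norm_zero]
    positivity

/-- A summable majorant for the shifted difference of the two series. -/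
noncomputable def majorant (L M : ℝ) (m : ℤ) : ℝ :=
  Real.exp (L / 2 * (1 + (M + Real.pi / L) ^ 2)) * Real.exp (-(L / 4) * m ^ 2)
    * (3 * Real.exp M * (2 + |(m : ℝ)|) + 1)

theorem summable_majorant {L : ℝ} (hL : 0 < L) (M : ℝ) : Summable (majorant L M) := by
  have hpi := Real.pi_pos
  -- Chosen so that `π T = L/4`; powers 0 and 1 of `|m|` then cover the linear factor of the
  -- majorant.
  have hT : 0 < L / (4 * Real.pi) := by positivity
  have h0 := summable_pow_mul_jacobiTheta₂_term_bound 0 hT 0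
  have h1 := summable_pow_mul_jacobiTheta₂_term_bound 0 hT 1
  have h := ((h0.mul_left (6 * Real.exp M + 1)).add (h1.mul_left (3 * Real.exp M))).mul_left
    (Real.exp (L / 2 * (1 + (M + Real.pi / L) ^ 2)))
  refine h.congr fun m => ?_
  have e : -Real.pi * (L / (4 * Real.pi) * (m : ℝ) ^ 2 - 2 * 0 * |(m : ℝ)|)
      = -(L / 4) * m ^ 2 := by
    field_simp
    ring
  simp only [Int.cast_abs, e, majorant]
  ring

theorem norm_gaussTerm_shift_le {L : ℝ} (hL : 0 < L) {v : ℂ} {W : ℝ} (hW : |v.im| ≤ W) (m : ℤ) :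
    ‖gaussTerm L (-v) (m + ⌊v.re⌋)‖
      ≤ Real.exp (L / 2 * (1 + W ^ 2)) * Real.exp (-(L / 4) * m ^ 2) := by
  rw [norm_gaussTerm, ← Real.exp_add, Real.exp_le_exp]
  have hf0 := Int.floor_le v.re
  have hf1 := Int.lt_floor_add_one v.re
  have him : v.im ^ 2 ≤ W ^ 2 := by
    rw [← sq_abs v.im]
    gcongr
  obtain ⟨f, hf⟩ : ∃ f : ℝ, f = v.re - ⌊v.re⌋ := ⟨_, rfl⟩
  have hre : ((m + ⌊v.re⌋ : ℤ) : ℝ) + (-v).re = m - f := by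
    rw [hf, Complex.neg_re]
    push_cast
    ring
  have hf2 : f ^ 2 ≤ 1 := by nlinarith
  rw [hre, Complex.neg_im, neg_sq]
  -- `(m - f)² - m²/2 + f² = (m - 2f)²/2`: half the decay pays for the fractional part `f`.
  have hsq : (m : ℝ) ^ 2 / 2 - 1 ≤ ((m : ℝ) - f) ^ 2 := by nlinarith [sq_nonneg ((m : ℝ) - 2 * f)]
  nlinarith

theorem abs_shift_sub_le (x : ℝ) (m : ℤ) : |((m + ⌊x⌋ : ℤ) : ℝ) - x| ≤ |(m : ℝ)| + 1 := by
  have hf0 := Int.floor_le x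
  have hf1 := Int.lt_floor_add_one x
  have e : ((m + ⌊x⌋ : ℤ) : ℝ) - x = m + (⌊x⌋ - x) := by push_cast; ring
  rw [e]
  refine (abs_add_le _ _).trans (add_le_add le_rfl ?_)
  rw [abs_le]
  constructor <;> linarith

theorem norm_gaussTerm_mul_sub_one_le {L : ℝ} (hL : 0 < L) {u : ℂ} (hu : 0 < u.re) {M : ℝ}
    (hM : |u.im| ≤ M) (hρ : ‖u‖ ≤ 2 * (centre L u).re) (m : ℤ) :
    ‖gaussTerm L (-centre L u) (m + ⌊(centre L u).re⌋)
      * (poissonRatioInt u (m + ⌊(centre L u).re⌋) - 1)‖ ≤ majorant L M m := by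
  rw [norm_mul, majorant]
  refine mul_le_mul (norm_gaussTerm_shift_le hL (abs_centre_im_le hL hM) m) ?_ (norm_nonneg _)
    (by positivity)
  refine (norm_sub_le _ _).trans ?_
  rw [norm_one]
  gcongr
  refine (norm_poissonRatioInt_le hu hM hρ _).trans (mul_le_mul_of_nonneg_left ?_ (by positivity))
  linarith [abs_shift_sub_le (centre L u).re m]

/-! ### Dominated convergence as `Re u → ∞` with `Im u` bounded -/

section Limit

variable {α : Type*} {l : Filter α} {u : α → ℂ} {L M : ℝ}

theorem tendsto_norm_of_re (hre : Tendsto (fun a => (u a).re) l atTop) :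
    Tendsto (fun a => ‖u a‖) l atTop :=
  tendsto_atTop_mono (fun a => Complex.re_le_norm (u a)) hre

/-- Passing from `‖u‖` to the real part of the centre loses at most `M` and `log ‖u‖ / L`, each
eventually at most `‖u‖/4`. -/
theorem eventually_norm_le_centre (hL : 0 < L) (hre : Tendsto (fun a => (u a).re) l atTop)
    (him : ∀ᶠ a in l, |(u a).im| ≤ M) : ∀ᶠ a in l, ‖u a‖ ≤ 2 * (centre L (u a)).re := by
  have hnorm := tendsto_norm_of_re hre
  have hlog : ∀ᶠ x : ℝ in atTop, Real.log x ≤ L / 4 * x := by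
    filter_upwards [Real.isLittleO_log_id_atTop.bound (show 0 < L / 4 by positivity),
      eventually_ge_atTop 0] with x hx h0
    rw [id, Real.norm_of_nonneg h0] at hx
    exact (le_abs_self _).trans hx
  filter_upwards [hnorm.eventually hlog, hnorm.eventually_ge_atTop (4 * M),
    hre.eventually_gt_atTop 0, him] with a h1 h2 h3 h4
  have h5 := Complex.norm_le_abs_re_add_abs_im (u a)
  rw [abs_of_pos h3] at h5
  have h6 : Real.log ‖u a‖ / L ≤ ‖u a‖ / 4 := by
    rw [div_le_iff₀ hL]
    linarith
  rw [centre_re]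
  linarith

theorem tendsto_log_affine_sq_div (c d : ℝ) :
    Tendsto (fun x : ℝ => (c * Real.log x + d) ^ 2 / (x / 4)) atTop (𝓝 0) := by
  have h1 : Tendsto (fun x : ℝ => Real.log x ^ 2 / x) atTop (𝓝 0) :=
    Real.isLittleO_pow_log_id_atTop.tendsto_div_nhds_zero
  have h2 : Tendsto (fun x : ℝ => Real.log x / x) atTop (𝓝 0) :=
    Real.isLittleO_log_id_atTop.tendsto_div_nhds_zero
  have h3 : Tendsto (fun x : ℝ => x⁻¹) atTop (𝓝 0) := tendsto_inv_atTop_zero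
  have h := ((h1.const_mul (4 * c ^ 2)).add (h2.const_mul (8 * c * d))).add
    (h3.const_mul (4 * d ^ 2))
  simp only [mul_zero, add_zero] at h
  refine h.congr' ?_
  filter_upwards [eventually_gt_atTop 0] with x hx
  field_simp
  ring

/-- For fixed `m` the index `n` stays within bounded distance of the centre, so `|u - n| = O(log
‖u‖)`, while `n ≥ ‖u‖/4`; thus `|u - n|²/n → 0`. -/
theorem tendsto_poissonRatioInt (hL : 0 < L) (hre : Tendsto (fun a => (u a).re) l atTop)
    (him : ∀ᶠ a in l, |(u a).im| ≤ M) (m : ℤ) :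
    Tendsto (fun a => poissonRatioInt (u a) (m + ⌊(centre L (u a)).re⌋)) l (𝓝 1) := by
  have hnorm := tendsto_norm_of_re hre
  have hcentre := eventually_norm_le_centre hL hre him
  have hk : ∀ᶠ a in l, ‖u a‖ / 4 ≤ ((m + ⌊(centre L (u a)).re⌋ : ℤ) : ℝ) := by
    filter_upwards [hcentre, hnorm.eventually_ge_atTop (4 * (|(m : ℝ)| + 1))] with a h1 h2
    have h3 := neg_abs_le (((m + ⌊(centre L (u a)).re⌋ : ℤ) : ℝ) - (centre L (u a)).re)
    have h4 := abs_shift_sub_le (centre L (u a)).re m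
    linarith
  have hcast : ∀ᶠ a in l, (((m + ⌊(centre L (u a)).re⌋).toNat : ℕ) : ℤ)
      = m + ⌊(centre L (u a)).re⌋ := by
    filter_upwards [hk] with a ha
    refine Int.toNat_of_nonneg ?_
    have : (0 : ℝ) ≤ ((m + ⌊(centre L (u a)).re⌋ : ℤ) : ℝ) := le_trans (by positivity) ha
    exact_mod_cast this
  have hn : Tendsto (fun a => (m + ⌊(centre L (u a)).re⌋).toNat) l atTop := by
    rw [← tendsto_natCast_atTop_iff (R := ℝ)]
    refine tendsto_atTop_mono' l ?_ (hnorm.atTop_div_const (show (0 : ℝ) < 4 by norm_num))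
    filter_upwards [hk, hcast] with a h1 h2
    rw [← h2] at h1
    exact_mod_cast h1
  have hu : ∀ᶠ a in l, u a ≠ 0 := by
    filter_upwards [hnorm.eventually_gt_atTop 0] with a ha
    exact norm_pos_iff.1 ha
  have hlim : Tendsto (fun a => ‖u a - ((m + ⌊(centre L (u a)).re⌋).toNat : ℕ)‖ ^ 2
      / ((m + ⌊(centre L (u a)).re⌋).toNat : ℕ)) l (𝓝 0) := by
    refine squeeze_zero' (.of_forall fun _ => by positivity) ?_
      ((tendsto_log_affine_sq_div (1 / L)
        (Real.pi / L + 1 / 2 + (|(m : ℝ)| + 1) + (M + Real.pi / L))).comp hnorm)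
    filter_upwards [hk, hcast, him, hnorm.eventually_ge_atTop 1] with a h1 h2 h3 h4
    obtain ⟨k, hkdef⟩ : ∃ k : ℕ, k = (m + ⌊(centre L (u a)).re⌋).toNat := ⟨_, rfl⟩
    rw [← hkdef] at h2 ⊢
    have hsh := abs_shift_sub_le (centre L (u a)).re m
    rw [← h2, Int.cast_natCast] at h1 hsh
    have hlogu : ‖Complex.log (u a)‖ ≤ Real.log ‖u a‖ + Real.pi := by
      refine (Complex.norm_le_abs_re_add_abs_im _).trans ?_
      rw [Complex.log_re, Complex.log_im, abs_of_nonneg (Real.log_nonneg h4)]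
      gcongr
      exact Complex.abs_arg_le_pi _
    have hv : ‖centre L (u a) - k‖ ≤ (|(m : ℝ)| + 1) + (M + Real.pi / L) := by
      refine (Complex.norm_le_abs_re_add_abs_im _).trans (add_le_add ?_ ?_)
      · rwa [Complex.sub_re, Complex.natCast_re, abs_sub_comm]
      · rw [Complex.sub_im, Complex.natCast_im, sub_zero]
        exact abs_centre_im_le hL h3
    have hb : ‖u a - k‖ ≤ 1 / L * Real.log ‖u a‖
        + (Real.pi / L + 1 / 2 + (|(m : ℝ)| + 1) + (M + Real.pi / L)) := by
      have e : u a - k = (Complex.log (u a) / L - 1 / 2) + (centre L (u a) - k) := by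
        rw [centre]; ring
      have h5 : ‖Complex.log (u a) / L‖ ≤ (Real.log ‖u a‖ + Real.pi) / L := by
        rw [norm_div, Complex.norm_real, Real.norm_of_nonneg hL.le]
        gcongr
      have h6 : ‖(1 / 2 : ℂ)‖ = 1 / 2 := by norm_num
      rw [e]
      refine (norm_add_le _ _).trans ?_
      have h7 := norm_sub_le (Complex.log (u a) / L) (1 / 2 : ℂ)
      rw [h6] at h7
      have h8 : (Real.log ‖u a‖ + Real.pi) / L = 1 / L * Real.log ‖u a‖ + Real.pi / L := by ring
      linarith
    simp only [Function.comp]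
    gcongr
  refine (tendsto_poissonRatio hn hu hlim).congr' ?_
  filter_upwards [hcast] with a ha
  conv_rhs => rw [← ha]
  rw [poissonRatioInt_natCast]

/-- Translating by the integer part of the centre holds the Gaussian in place, so a single majorant
serves. Extending the ratio by zero puts the missing negative indices into the same difference
series. -/
theorem tendsto_tsum_poissonRatio_sub (hL : 0 < L) (hre : Tendsto (fun a => (u a).re) l atTop)
    (him : ∀ᶠ a in l, |(u a).im| ≤ M) :
    Tendsto (fun a => ∑' n : ℕ, gaussTerm L (-centre L (u a)) n * poissonRatio (u a) n
      - ∑' k : ℤ, gaussTerm L (-centre L (u a)) k) l (𝓝 0) := by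
  have hbound : ∀ᶠ a in l, ∀ m : ℤ, ‖gaussTerm L (-centre L (u a)) (m + ⌊(centre L (u a)).re⌋)
      * (poissonRatioInt (u a) (m + ⌊(centre L (u a)).re⌋) - 1)‖ ≤ majorant L M m := by
    filter_upwards [hre.eventually_gt_atTop 0, him, eventually_norm_le_centre hL hre him]
      with a h1 h2 h3 m
    exact norm_gaussTerm_mul_sub_one_le hL h1 h2 h3 m
  have hlim : ∀ m : ℤ, Tendsto (fun a =>
      gaussTerm L (-centre L (u a)) (m + ⌊(centre L (u a)).re⌋)
        * (poissonRatioInt (u a) (m + ⌊(centre L (u a)).re⌋) - 1)) l (𝓝 0) := by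
    intro m
    have h1 := (tendsto_poissonRatioInt hL hre him m).sub_const 1
    rw [sub_self] at h1
    refine isBoundedUnder_le_mul_tendsto_zero (isBoundedUnder_of_eventually_le
      (a := Real.exp (L / 2 * (1 + (M + Real.pi / L) ^ 2)) * Real.exp (-(L / 4) * m ^ 2)) ?_) h1
    filter_upwards [him] with a ha
    exact norm_gaussTerm_shift_le hL (abs_centre_im_le hL ha) m
  have hsum := tendsto_tsum_of_dominated_convergence (summable_majorant hL M) hlim hbound
  rw [tsum_zero] at hsum
  refine hsum.congr' ?_
  filter_upwards [hbound] with a ha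
  have hs : Summable fun k : ℤ => gaussTerm L (-centre L (u a)) k
      * (poissonRatioInt (u a) k - 1) :=
    (Equiv.addRight ⌊(centre L (u a)).re⌋).summable_iff.1
      (.of_norm_bounded (summable_majorant hL M) ha)
  have hg := summable_gaussTerm hL (-centre L (u a))
  have e1 := (Equiv.addRight ⌊(centre L (u a)).re⌋).tsum_eq
    (fun k : ℤ => gaussTerm L (-centre L (u a)) k * (poissonRatioInt (u a) k - 1))
  simp only [Equiv.coe_addRight] at e1
  have e2 : ∑' n : ℕ, gaussTerm L (-centre L (u a)) n * poissonRatio (u a) n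
      = ∑' k : ℤ, gaussTerm L (-centre L (u a)) k * poissonRatioInt (u a) k := by
    have hsupp : Function.support (fun k : ℤ => gaussTerm L (-centre L (u a)) k
        * poissonRatioInt (u a) k) ⊆ Set.range ((↑) : ℕ → ℤ) := by
      intro k hk
      by_contra hneg
      have hk0 : ¬ 0 ≤ k := fun h => hneg ⟨k.toNat, Int.toNat_of_nonneg h⟩
      exact hk (by simp [poissonRatioInt, hk0])
    rw [← (Nat.cast_injective (R := ℤ)).tsum_eq hsupp]
    simp_rw [poissonRatioInt_natCast]
  have e3 : (fun k : ℤ => gaussTerm L (-centre L (u a)) k * poissonRatioInt (u a) k)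
      = fun k => gaussTerm L (-centre L (u a)) k * (poissonRatioInt (u a) k - 1)
        + gaussTerm L (-centre L (u a)) k := by
    ext k; ring
  rw [e1, e2, e3, hs.tsum_add hg, add_sub_cancel_right]

end Limit

/-! ### The prefactor -/

theorem log_div_neg_log {lam : ℝ} (h0 : 0 < lam) (h1 : lam < 1) {w : ℂ} (hw : w ≠ 0) :
    Complex.log (w / ((-Real.log lam : ℝ) : ℂ))
      = Complex.log w - (Real.log (-Real.log lam) : ℂ) := by
  have hL : 0 < -Real.log lam := neg_pos.2 (Real.log_neg h0 h1)
  rw [div_eq_inv_mul, ← Complex.ofReal_inv, Complex.log_ofReal_mul (inv_pos.2 hL) hw,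
    Real.log_inv]
  push_cast
  ring

theorem phase_eq {lam : ℝ} (h0 : 0 < lam) (h1 : lam < 1) {z : ℂ} (hz : Complex.log z ≠ 0) :
    phase lam z = -centre (-Real.log lam) (Complex.log z / ((-Real.log lam : ℝ) : ℂ)) := by
  have hL : (Real.log lam : ℂ) ≠ 0 := by exact_mod_cast (Real.log_neg h0 h1).ne
  rw [phase, centre, log_div_neg_log h0 h1 hz]
  push_cast
  field_simp
  ring

theorem prefactor_ne_zero (lam : ℝ) {z : ℂ} (hz : z ≠ 0) (hz' : Complex.log z ≠ 0) :
    prefactor lam z ≠ 0 := by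
  have hC : (constC lam : ℂ) ≠ 0 := by
    exact_mod_cast (Real.exp_pos _).ne'
  exact mul_ne_zero (mul_ne_zero (mul_ne_zero hC (by simp [Complex.cpow_eq_zero_iff, hz]))
    (by simp [Complex.cpow_eq_zero_iff, hz'])) (Complex.exp_ne_zero _)

theorem eventually_ne_zero_and_log_ne_zero :
    ∀ᶠ z : ℂ in Bornology.cobounded ℂ, z ≠ 0 ∧ Complex.log z ≠ 0 := by
  filter_upwards [tendsto_norm_cobounded_atTop.eventually_gt_atTop 1] with z hz
  refine ⟨norm_pos_iff.1 (by linarith), fun h => ?_⟩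
  have h1 := congrArg Complex.re h
  rw [Complex.log_re, Complex.zero_re] at h1
  exact (Real.log_pos hz).ne' h1

/-- The exponent `-L n²/2 + n (L u + L/2 - log u)` equals `-L (n - c)²/2 + L c²/2`, so the prefactor
is `e^{u + L c²/2} / √(2πu)`; this is where `A`, `B` and `C` come from. -/
theorem seriesTerm_eq {lam : ℝ} (h0 : 0 < lam) (h1 : lam < 1) {z : ℂ} (hz : z ≠ 0)
    (hz' : Complex.log z ≠ 0) (n : ℕ) :
    seriesTerm lam z n = prefactor lam z * (gaussTerm (-Real.log lam) (phase lam z) n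
      * poissonRatio (Complex.log z / ((-Real.log lam : ℝ) : ℂ)) n) := by
  have hL : 0 < -Real.log lam := neg_pos.2 (Real.log_neg h0 h1)
  have hLc : (Real.log lam : ℂ) ≠ 0 := by exact_mod_cast (Real.log_neg h0 h1).ne
  have hu : Complex.log z / ((-Real.log lam : ℝ) : ℂ) ≠ 0 :=
    div_ne_zero hz' (by exact_mod_cast hL.ne')
  have hlam : (lam : ℂ) ^ n.choose 2
      = Complex.exp ((Real.log lam : ℂ) * (n * (n - 1) / 2)) := by
    have : (lam : ℂ) = Complex.exp (Real.log lam : ℂ) := by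
      rw [← Complex.ofReal_exp, Real.exp_log h0]
    conv_lhs => rw [this]
    rw [← Complex.exp_nat_mul, Nat.cast_choose_two, mul_comm]
  have hzn : z ^ n = Complex.exp (n * Complex.log z) := by
    rw [Complex.exp_nat_mul, Complex.exp_log hz]
  have hun : (Complex.log z / ((-Real.log lam : ℝ) : ℂ)) ^ n
      = Complex.exp (n * (Complex.log (Complex.log z) - (Real.log (-Real.log lam) : ℂ))) := by
    rw [← log_div_neg_log h0 h1 hz', Complex.exp_nat_mul, Complex.exp_log hu]
  have hsq : (Real.sqrt (2 * Real.pi) : ℂ) = Complex.exp ((Real.log (2 * Real.pi) : ℂ) / 2) := by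
    rw [Real.sqrt_eq_rpow, Real.rpow_def_of_pos (by positivity)]
    push_cast
    ring_nf
  rw [seriesTerm, prefactor, gaussTerm, poissonRatio, hun, log_div_neg_log h0 h1 hz', hsq, hlam,
    hzn, Complex.cpow_def_of_ne_zero hz, Complex.cpow_def_of_ne_zero hz', constC, phase, expA,
    expB, Complex.ofReal_exp, zpow_natCast]
  -- With all factors written as exponentials, only an algebraic identity between exponents in the
  -- logarithms remains.
  generalize Complex.log (Complex.log z) = s
  generalize Complex.log z = t
  generalize Real.log (-Real.log lam) = p
  generalize Real.log (2 * Real.pi) = q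
  generalize Real.log lam = r at *
  have comb : ∀ a b c d e f g h k i j w m : ℂ, i + j = a + b + c + d + e + f + g + h + k →
      w * Complex.exp i * Complex.exp j / m
        = Complex.exp a * Complex.exp b * Complex.exp c * Complex.exp d * (w * Complex.exp e
          * (Complex.exp f * Complex.exp g * Complex.exp h * Complex.exp k / m)) := by
    intro a b c d e f g h k i j w m hk
    rw [mul_assoc w, ← Complex.exp_add, hk]
    simp only [Complex.exp_add]
    ring
  apply comb
  push_cast
  field_simp
  ring

theorem tendsto_div_prefactor_sub {lam : ℝ} (h0 : 0 < lam) (h1 : lam < 1) {g : ℂ → ℂ}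
    (hg : IsEntireSolution lam g) :
    Tendsto (fun z => g z / prefactor lam z - thetaH lam (phase lam z))
      (Bornology.cobounded ℂ) (𝓝 0) := by
  have hL : 0 < -Real.log lam := neg_pos.2 (Real.log_neg h0 h1)
  have hre : Tendsto (fun z : ℂ => (Complex.log z / ((-Real.log lam : ℝ) : ℂ)).re)
      (Bornology.cobounded ℂ) atTop := by
    simp_rw [Complex.div_ofReal_re, Complex.log_re]
    exact (Real.tendsto_log_atTop.comp tendsto_norm_cobounded_atTop).atTop_div_const hL
  have him : ∀ᶠ z : ℂ in Bornology.cobounded ℂ,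
      |(Complex.log z / ((-Real.log lam : ℝ) : ℂ)).im| ≤ Real.pi / (-Real.log lam) := by
    refine .of_forall fun z => ?_
    rw [Complex.div_ofReal_im, Complex.log_im, abs_div, abs_of_pos hL]
    gcongr
    exact Complex.abs_arg_le_pi z
  refine (tendsto_tsum_poissonRatio_sub hL hre him).congr' ?_
  filter_upwards [eventually_ne_zero_and_log_ne_zero] with z hz
  have hp := prefactor_ne_zero lam hz.1 hz.2
  rw [← phase_eq h0 h1 hz.2, thetaH_eq_tsum_gaussTerm h0 h1, hg.eq_tsum,
    tsum_congr (seriesTerm_eq h0 h1 hz.1 hz.2), tsum_mul_left, mul_div_cancel_left₀ _ hp]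

end Pantograph

theorem theorem2p1 (lam : ℝ) (hlam0 : 0 < lam) (hlam1 : lam < 1) :
    (∃! g : ℂ → ℂ, Pantograph.IsEntireSolution lam g) ∧
    (∀ x : ℂ, Summable (Pantograph.fourierTerm lam x)) ∧
    Function.Periodic (Pantograph.thetaH lam) 2 ∧
    ∀ g : ℂ → ℂ, Pantograph.IsEntireSolution lam g → ∀ ε : ℝ, 0 < ε →
      ((fun z : ℂ => g z -
            Pantograph.prefactor lam z * Pantograph.thetaH lam (Pantograph.phase lam z))
          =o[Bornology.cobounded ℂ ⊓ 𝓟 (Pantograph.sector ε)]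
        Pantograph.prefactor lam) ∧
      ∀ δ : ℝ, 0 < δ →
        g ~[Bornology.cobounded ℂ ⊓ 𝓟 (Pantograph.sector ε ∩
              {z | δ ≤ ‖Pantograph.thetaH lam (Pantograph.phase lam z)‖})]
          (fun z : ℂ =>
            Pantograph.prefactor lam z * Pantograph.thetaH lam (Pantograph.phase lam z)) := by
  open Pantograph in
  refine ⟨⟨_, isEntireSolution_tsum hlam0 hlam1, fun g hg => funext hg.eq_tsum⟩,
    summable_fourierTerm hlam0 hlam1, thetaH_periodic lam, fun g hg ε _ => ?_⟩
  have hmain : (fun z : ℂ => g z - prefactor lam z * thetaH lam (phase lam z))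
      =o[Bornology.cobounded ℂ] prefactor lam := by
    rw [isLittleO_iff_exists_eq_mul]
    refine ⟨_, tendsto_div_prefactor_sub hlam0 hlam1 hg, ?_⟩
    filter_upwards [eventually_ne_zero_and_log_ne_zero] with z hz
    have hp := prefactor_ne_zero lam hz.1 hz.2
    simp only [Pi.mul_apply]
    field_simp
  refine ⟨hmain.mono inf_le_left, fun δ hδ => ?_⟩
  -- Where `|H| ≥ δ`, one has `|P| ≤ δ⁻¹ |P H|`, so the error is also small relative to `P H`.
  refine (hmain.mono inf_le_left).trans_isBigO (IsBigO.of_bound δ⁻¹ ?_)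
  filter_upwards [mem_inf_of_right (mem_principal_self _)] with z hz
  have hz' : δ ≤ ‖thetaH lam (phase lam z)‖ := hz.2
  rw [norm_mul, inv_mul_eq_div, le_div_iff₀ hδ]
  gcongr
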